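/- Let $k$ be a finite field of characteristic $p$ with $q$ elements, let $\bar k$ be an algebraic closure of $k$, and let $W(\cdot)$ denote the ring of ($p$-typical, infinite) Witt vectors. For every algebraic extension $F/k$ let $\pi:W(F)\to W(F)$ be the automorphism induced by $x\mapsto x^q$ on $F$. Give $W(\bar k)$ its $p$-adic topology, and for finite extensions $k\subset E\subset L\subset\bar k$ let $\mathrm{Trace}_{L/E}:W(L)\to W(E)$ be the trace of the finite free $W(E)$-algebra $W(L)$. An element $\theta\in W(E)$, where $r=[E:k]$, is called a normal basis generator if $\theta,\pi\theta,\dots,\pi^{r-1}\theta$ is a basis of the $W(k)$-module $W(E)$. There exist a family $(\theta_E)_E$, indexed by the finite extensions $E/k$ inside $\bar k$, of normal basis generators $\theta_E\in W(E)$ with $\mathrm{Trace}_{L/E}(\theta_L)=\theta_E$ whenever $L\supset E\supset k$, and a continuous $W(k)$-linear map $\bar\tau:W(\bar k)\to W(\bar k)$, such that: 1. $\bar\tau^2=I$. 2. $\bar\tau\pi=\pi^{-1}\bar\tau$. 3. For every finite extension $E/k$ in $\bar k$, $\bar\tau$ preserves $W(E)\subset W(\bar k)$; write $\tau_E$ for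 the restriction of $\bar\tau$ to $W(E)$. 4. For all finite extensions $L\supset E\supset k$ in $\bar k$, $\mathrm{Trace}_{L/E}\circ\tau_L=\tau_E\circ\mathrm{Trace}_{L/E}$ as maps $W(L)\to W(E)$, and $\tau_L$ and $\tau_E$ commute with the inclusion $W(E)\subset W(L)$. 5. For every finite extension $E/k$ in $\bar k$ and every $i\in\mathbb Z$, $\tau_E(\pi^i\theta_E)=\pi^{-i}\theta_E$. -/

import Mathlib

open scoped Topology

namespace WittInvolution

noncomputable section

/-- For an `A`-algebra `B`, the Witt vectors of `B` form an algebra over the Witt vectors of `A`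
through the functorial map `W(A) → W(B)`. -/
instance wittAlgebra (p : ℕ) [Fact p.Prime] (A B : Type*) [CommRing A] [CommRing B]
    [Algebra A B] : Algebra (WittVector p A) (WittVector p B) :=
  (WittVector.map (algebraMap A B)).toAlgebra

/-- The automorphism `W(e)` of `W(A)` induced by a ring automorphism `e` of `A`. -/
def wittAut (p : ℕ) [Fact p.Prime] {A : Type*} [CommRing A] (e : RingAut A) :
    RingAut (WittVector p A) :=
  RingEquiv.ofRingHom (WittVector.map (e : A →+* A)) (WittVector.map (e.symm : A →+* A))
    (by ext x n; simp [WittVector.map_coeff])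
    (by ext x n; simp [WittVector.map_coeff])

/-- The automorphism `π` of `W(F)`, for an algebraic extension `F` of the finite field `k`,
that lifts the automorphism `x ↦ x ^ q` of `F`, where `q = |k|`. -/
def frob (p : ℕ) [Fact p.Prime] (k F : Type*) [Field k] [Fintype k] [Field F] [Algebra k F]
    [Algebra.IsAlgebraic k F] : RingAut (WittVector p F) :=
  wittAut p (FiniteField.frobeniusAlgEquivOfAlgebraic k F : F ≃+* F)

/-- The `p`-adic topology on `W(F)`. -/
abbrev padicTopology (p : ℕ) [Fact p.Prime] (F : Type*) [CommRing F] :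
    TopologicalSpace (WittVector p F) :=
  (Ideal.span {(p : WittVector p F)}).adicTopology

/-- The trace `W(B) → W(A)` along `W(f)`, for a ring homomorphism `f : A → B`. It is used where
`W(B)` is a free `W(A)`-module of finite rank. -/
def wittTrace (p : ℕ) [Fact p.Prime] {A B : Type*} [CommRing A] [CommRing B] (f : A →+* B) :
    WittVector p B → WittVector p A :=
  letI : Algebra (WittVector p A) (WittVector p B) := (WittVector.map f).toAlgebra
  Algebra.trace (WittVector p A) (WittVector p B)

/-- `θ ∈ W(E)` is a normal basis generator over `W(k)`, where `E / k` has degree `r`: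
`θ, π θ, …, π ^ (r - 1) θ` is a basis of the `W(k)`-module `W(E)`. -/
def IsNormalBasisGenerator (p : ℕ) [Fact p.Prime] (k : Type*) {E : Type*} [Field k] [Fintype k]
    [Field E] [Algebra k E] [FiniteDimensional k E] (θ : WittVector p E) : Prop :=
  LinearIndependent (WittVector p k)
      (fun i : Fin (Module.finrank k E) => (frob p k E ^ (i : ℕ)) θ) ∧
    Submodule.span (WittVector p k)
      (Set.range fun i : Fin (Module.finrank k E) => (frob p k E ^ (i : ℕ)) θ) = ⊤

/-- The inclusion `W(E) → W(L)` for subextensions `E ≤ L` of `K / k`. -/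
def incl (p : ℕ) [Fact p.Prime] {k K : Type*} [Field k] [Field K] [Algebra k K]
    {E L : IntermediateField k K} (h : E ≤ L) : WittVector p E →+* WittVector p L :=
  WittVector.map (IntermediateField.inclusion h : E →+* L)

/-- The trace `W(L) → W(E)` for subextensions `E ≤ L` of `K / k`. -/
def trace (p : ℕ) [Fact p.Prime] {k K : Type*} [Field k] [Field K] [Algebra k K]
    {E L : IntermediateField k K} (h : E ≤ L) : WittVector p L → WittVector p E :=
  wittTrace p (IntermediateField.inclusion h : E →+* L)

end

end WittInvolution

/-! If the residue of θ in E is a normal element over k, the conjugates of θ form a W(k)-basis of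
W(E): independence and spanning lift from residue fields because Witt vectors are p-adically
separated and complete (`linearIndependent_of_constantCoeff`, `span_eq_top_of_constantCoeff`).
Traces commute with residues and preserve normality, so a trace-compatible family θ_E exists by
compactness: Witt vectors over a finite field form a compact space
(`exists_compatible_isNormalElement`).

Let τ_E send σθ_E to σ⁻¹θ_E (`inversion`). It is an involution, and it inverts π because Gal(E/k) is
abelian. It commutes with traces because restriction of automorphisms respects inverses
(`trace_inversion`). It commutes with inclusions because θ_E is the sum of σθ_L over the group
Gal(L/E), which is closed under inversion (`inversion_algebraMap`).

The union of the W(E) is p-adically dense in W(kbar), and linear maps preserve congruences mod p^n.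
So the τ_E extend to W(kbar) (`exists_linearMap_extending`), where identities can be checked mod p^n
on a single W(E). -/

namespace WittInvolution

open WittVector

/-! ### Lifting bases from the residue field to Witt vectors -/

section WittBasis

variable {p : ℕ} [Fact p.Prime]

lemma p_dvd_iff_constantCoeff_eq_zero {R : Type*} [CommRing R] [CharP R p] [PerfectRing R p]
    (x : WittVector p R) : (p : WittVector p R) ∣ x ↔ constantCoeff x = 0 := by
  rw [← Ideal.mem_span_singleton, mem_span_p_iff_coeff_zero_eq_zero]
  rfl

lemma eq_zero_of_forall_pow_dvd {R : Type*} [CommRing R] [CharP R p] [PerfectRing R p]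
    (x : WittVector p R) (h : ∀ n : ℕ, (p : WittVector p R) ^ n ∣ x) : x = 0 := by
  ext n
  have := (mem_span_p_pow_iff_le_coeff_eq_zero x (n + 1)).1
    (Ideal.mem_span_singleton.2 (h (n + 1))) n (Nat.lt_succ_self n)
  simpa using this

variable {A B : Type*} [Field A] [Field B] [Algebra A B]

lemma algebraMap_witt : algebraMap (WittVector p A) (WittVector p B) =
    WittVector.map (algebraMap A B) := rfl

lemma smul_witt (a : WittVector p A) (x : WittVector p B) :
    a • x = WittVector.map (algebraMap A B) a * x := rfl

@[simp]
lemma constantCoeff_map {R S : Type*} [CommRing R] [CommRing S] (f : R →+* S)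
    (x : WittVector p R) : constantCoeff (WittVector.map f x) = f (constantCoeff x) := rfl

@[simp]
lemma constantCoeff_smul (a : WittVector p A) (x : WittVector p B) :
    constantCoeff (a • x) = constantCoeff a • constantCoeff x := by
  rw [smul_witt, _root_.map_mul, constantCoeff_map, Algebra.smul_def]

/-- The map `W(f)` of Witt vectors, as a homomorphism of `W(A)`-algebras. -/
noncomputable def mapAlgHom {C : Type*} [Field C] [Algebra A C] (f : B →ₐ[A] C) :
    WittVector p B →ₐ[WittVector p A] WittVector p C :=
  { WittVector.map (f : B →+* C) with
    commutes' := fun a => by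
      ext n
      simp [algebraMap_witt, WittVector.map_coeff] }

@[simp]
lemma mapAlgHom_coeff {C : Type*} [Field C] [Algebra A C] (f : B →ₐ[A] C)
    (x : WittVector p B) (n : ℕ) : (mapAlgHom f x).coeff n = f (x.coeff n) := rfl

@[simp]
lemma constantCoeff_mapAlgHom {C : Type*} [Field C] [Algebra A C] (f : B →ₐ[A] C)
    (x : WittVector p B) : constantCoeff (mapAlgHom f x) = f (constantCoeff x) := rfl

variable [CharP A p] [CharP B p] [PerfectRing A p] [PerfectRing B p]

/-- Modulo p a relation becomes trivial, so p divides its coefficients. Since p is a nonzerodivisor,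
the quotient is again a relation; by iteration every power of p divides the coefficients. -/
lemma linearIndependent_of_constantCoeff {ι : Type*} [Finite ι] (b : ι → WittVector p B)
    (h : LinearIndependent A fun i => constantCoeff (b i)) :
    LinearIndependent (WittVector p A) b := by
  have := Fintype.ofFinite ι
  rw [Fintype.linearIndependent_iff] at h ⊢
  suffices H : ∀ (n : ℕ) (g : ι → WittVector p A), ∑ i, g i • b i = 0 →
      ∀ i, (p : WittVector p A) ^ n ∣ g i from
    fun g hg i => eq_zero_of_forall_pow_dvd _ fun n => H n g hg i
  intro n
  induction n with
  | zero => simp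
  | succ n ih =>
    intro g hg
    have h0 := h (fun i => constantCoeff (g i)) (by
      simpa only [map_sum, constantCoeff_smul, _root_.map_zero] using
        congrArg (constantCoeff (p := p)) hg)
    choose g' hg' using fun i => (p_dvd_iff_constantCoeff_eq_zero (g i)).2 (h0 i)
    have h1 : ∑ i, g' i • b i = 0 := by
      apply eq_zero_of_p_mul_eq_zero (p := p)
      rw [← hg, Finset.sum_mul]
      refine Finset.sum_congr rfl fun i _ => ?_
      rw [hg', smul_witt, smul_witt, _root_.map_mul, map_natCast]
      ring
    intro i
    rw [hg', pow_succ']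
    exact mul_dvd_mul_left _ (ih g' h1 i)

lemma span_eq_top_of_constantCoeff {ι : Type*} [Finite ι] (b : ι → WittVector p B)
    (h : Submodule.span A (Set.range fun i => constantCoeff (b i)) = ⊤) :
    Submodule.span (WittVector p A) (Set.range b) = ⊤ := by
  have := Fintype.ofFinite ι
  have step : ∀ y : WittVector p B, ∃ (a : ι → WittVector p A) (r : WittVector p B),
      y = ∑ i, a i • b i + p * r := by
    intro y
    obtain ⟨c, hc⟩ := (Submodule.mem_span_range_iff_exists_fun A).1
      (h ▸ Submodule.mem_top : constantCoeff y ∈ _)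
    choose a ha using fun i => constantCoeff_surjective p (c i)
    have : (p : WittVector p B) ∣ y - ∑ i, a i • b i := by
      rw [p_dvd_iff_constantCoeff_eq_zero]
      simp only [map_sub, map_sum, constantCoeff_smul, ha, hc, sub_self]
    obtain ⟨r, hr⟩ := this
    exact ⟨a, r, by rw [← hr]; ring⟩
  choose a r har using step
  refine eq_top_iff.2 fun y _ => ?_
  -- Partial sums of the p-adic expansion of the coordinates of `y`, produced by iterating the
  -- remainder map `r`.
  let s : ι → ℕ → WittVector p A := fun i n =>
    ∑ m ∈ Finset.range n, (p : WittVector p A) ^ m * a (r^[m] y) i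
  have hs : ∀ n, y = ∑ i, s i n • b i + (p : WittVector p B) ^ n * r^[n] y := by
    intro n
    induction n with
    | zero => simp [s]
    | succ n ih =>
      have hsum : ∑ i, s i (n + 1) • b i =
          ∑ i, s i n • b i + (p : WittVector p B) ^ n * ∑ i, a (r^[n] y) i • b i := by
        rw [Finset.mul_sum, ← Finset.sum_add_distrib]
        refine Finset.sum_congr rfl fun i _ => ?_
        have hsn : s i (n + 1) = s i n + (p : WittVector p A) ^ n * a (r^[n] y) i :=
          Finset.sum_range_succ _ _
        rw [hsn, add_smul, mul_smul, smul_witt ((p : WittVector p A) ^ n), map_pow, map_natCast]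
      rw [hsum, Function.iterate_succ_apply', pow_succ, mul_assoc, add_assoc, ← mul_add,
        ← har (r^[n] y)]
      exact ih
  have lim : ∀ i, ∃ c : WittVector p A, ∀ n, (p : WittVector p A) ^ n ∣ s i n - c := by
    intro i
    obtain ⟨c, hc⟩ := (isAdicCompleteIdealSpanP (p := p) (k := A)).toIsPrecomplete.prec'
      (s i) (by
        intro m n hmn
        rw [SModEq.sub_mem, smul_eq_mul, Ideal.mul_top, Ideal.span_singleton_pow,
          Ideal.mem_span_singleton, ← dvd_neg, neg_sub]
        have hsub : s i n - s i m =
            ∑ j ∈ Finset.Ico m n, (p : WittVector p A) ^ j * a (r^[j] y) i :=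
          (Finset.sum_Ico_eq_sub _ hmn).symm
        rw [hsub]
        exact Finset.dvd_sum fun j hj => dvd_mul_of_dvd_left (pow_dvd_pow _ (Finset.mem_Ico.1 hj).1) _)
    refine ⟨c, fun n => ?_⟩
    have := hc n
    rwa [SModEq.sub_mem, smul_eq_mul, Ideal.mul_top, Ideal.span_singleton_pow,
      Ideal.mem_span_singleton] at this
  choose c hc using lim
  rw [Submodule.mem_span_range_iff_exists_fun]
  refine ⟨c, (sub_eq_zero.1 <| eq_zero_of_forall_pow_dvd _ fun n => ?_).symm⟩
  rw [hs n, add_sub_right_comm, ← Finset.sum_sub_distrib]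
  refine dvd_add (Finset.dvd_sum fun i _ => ?_) (dvd_mul_right _ _)
  obtain ⟨d, hd⟩ := hc i n
  rw [← sub_smul, hd, smul_witt, _root_.map_mul, map_pow, map_natCast, mul_assoc]
  exact dvd_mul_right _ _

end WittBasis

/-! ### Normal elements, normal bases and the trace as a sum of conjugates -/

section NormalBasis

variable {p : ℕ} [Fact p.Prime] {A B : Type*} [Field A] [Field B] [Algebra A B]
  [FiniteDimensional A B]

/-- The conjugates of `a` are linearly independent. -/
def IsNormalElement (A : Type*) {B : Type*} [Field A] [Field B] [Algebra A B] (a : B) : Prop :=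
  LinearIndependent A fun σ : B ≃ₐ[A] B => σ a

lemma IsNormalElement.span_eq_top [IsGalois A B] {a : B} (h : IsNormalElement A a) :
    Submodule.span A (Set.range fun σ : B ≃ₐ[A] B => σ a) = ⊤ :=
  LinearIndependent.span_eq_top_of_card_eq_finrank' h
    (Fintype.card_eq_nat_card.trans (IsGalois.card_aut_eq_finrank A B))

/-- The trace is surjective and carries conjugates to conjugates, so the conjugates of the image
span A. There are only [A : K] of them, hence they are independent. -/
lemma IsNormalElement.trace {K : Type*} [Field K] [Algebra K A] [Algebra K B]
    [IsScalarTower K A B] [FiniteDimensional K A] [IsGalois K A]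
    [FiniteDimensional K B] [IsGalois K B] {a : B} (h : IsNormalElement K a) :
    IsNormalElement K (Algebra.trace A B a) := by
  have : IsGalois A B := IsGalois.tower_top_of_isGalois K A B
  have key : ∀ σ : B ≃ₐ[K] B,
      Algebra.trace A B (σ a) = AlgEquiv.restrictNormal σ A (Algebra.trace A B a) := by
    intro σ
    rw [Algebra.trace_eq_of_equiv_equiv (AlgEquiv.restrictNormal σ A).toRingEquiv σ.toRingEquiv
      (by ext x; exact AlgEquiv.restrictNormal_commutes σ A x) a]
    simp
  refine linearIndependent_of_top_le_span_of_card_eq_finrank ?_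
    (Fintype.card_eq_nat_card.trans (IsGalois.card_aut_eq_finrank K A))
  have h1 := congrArg (Submodule.map ((Algebra.trace A B).restrictScalars K)) h.span_eq_top
  rw [Submodule.map_span, Submodule.map_top, LinearMap.range_eq_top.2
    (by exact Algebra.trace_surjective A B), ← Set.range_comp] at h1
  rw [← h1]
  refine Submodule.span_mono ?_
  rintro _ ⟨σ, rfl⟩
  exact ⟨AlgEquiv.restrictNormal σ A, (key σ).symm⟩

variable (p A B) in
lemma exists_isNormalElement_constantCoeff [IsGalois A B] :
    ∃ θ : WittVector p B, IsNormalElement A (constantCoeff θ) := by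
  obtain ⟨a, ha⟩ := exists_linearIndependent_algEquiv_apply A B
  obtain ⟨θ, rfl⟩ := constantCoeff_surjective p a
  exact ⟨θ, ha⟩

variable [IsGalois A B] [CharP A p] [CharP B p] [PerfectRing A p] [PerfectRing B p]

/-- The conjugates of a lift of a normal element form a basis. -/
noncomputable def wittNormalBasis {θ : WittVector p B}
    (h : IsNormalElement A (constantCoeff θ)) :
    Module.Basis (B ≃ₐ[A] B) (WittVector p A) (WittVector p B) :=
  Module.Basis.mk (v := fun σ : B ≃ₐ[A] B => mapAlgHom (σ : B →ₐ[A] B) θ)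
    (linearIndependent_of_constantCoeff _ (by simpa only [constantCoeff_mapAlgHom] using! h))
    (span_eq_top_of_constantCoeff _
      (by simpa only [constantCoeff_mapAlgHom] using! h.span_eq_top)).ge

@[simp]
lemma wittNormalBasis_apply {θ : WittVector p B} (h : IsNormalElement A (constantCoeff θ))
    (σ : B ≃ₐ[A] B) : wittNormalBasis h σ = mapAlgHom (σ : B →ₐ[A] B) θ := by
  simp [wittNormalBasis]

variable (p A B) in
lemma finite_witt : Module.Finite (WittVector p A) (WittVector p B) :=
  have ⟨_, h⟩ := exists_isNormalElement_constantCoeff p A B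
  .of_basis (wittNormalBasis h)

variable (p A B) in
lemma free_witt : Module.Free (WittVector p A) (WittVector p B) :=
  have ⟨_, h⟩ := exists_isNormalElement_constantCoeff p A B
  .of_basis (wittNormalBasis h)

lemma algebraMap_trace_witt (x : WittVector p B) :
    algebraMap (WittVector p A) (WittVector p B)
        (Algebra.trace (WittVector p A) (WittVector p B) x) =
      ∑ σ : B ≃ₐ[A] B, mapAlgHom (σ : B →ₐ[A] B) x := by
  classical
  obtain ⟨θ, h⟩ := exists_isNormalElement_constantCoeff p A B
  let b := wittNormalBasis h
  have hmul : ∀ (σ τ : B ≃ₐ[A] B) (y : WittVector p B),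
      mapAlgHom (σ : B →ₐ[A] B) (mapAlgHom (τ : B →ₐ[A] B) y) =
        mapAlgHom ((σ * τ : B ≃ₐ[A] B) : B →ₐ[A] B) y := fun _ _ _ => rfl
  have hone : ∀ y : WittVector p B, mapAlgHom ((1 : B ≃ₐ[A] B) : B →ₐ[A] B) y = y :=
    fun y => by ext; simp
  -- `σ` permutes the basis by left translation, which moves index 1 to index `σ`.
  have hrepr : ∀ (σ : B ≃ₐ[A] B) (y : WittVector p B),
      b.repr (mapAlgHom (σ : B →ₐ[A] B) y) σ = b.repr y 1 := by
    intro σ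
    have : (b.coord σ).comp (mapAlgHom (σ : B →ₐ[A] B)).toLinearMap = b.coord 1 := by
      refine b.ext fun τ => ?_
      have : mapAlgHom (σ : B →ₐ[A] B) (b τ) = b (σ * τ) := by simp [b, hmul]
      rw [LinearMap.comp_apply, AlgHom.toLinearMap_apply, this]
      simp [Finsupp.single_apply]
    exact fun y => LinearMap.congr_fun this y
  -- The sum of conjugates is Galois invariant, so each of its Witt coefficients lies in A.
  obtain ⟨z, hz⟩ : ∃ z, algebraMap (WittVector p A) (WittVector p B) z =
      ∑ σ : B ≃ₐ[A] B, mapAlgHom (σ : B →ₐ[A] B) x := by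
    have hfix : ∀ n, (∑ σ : B ≃ₐ[A] B, mapAlgHom (σ : B →ₐ[A] B) x).coeff n ∈
        (⊥ : IntermediateField A B) := by
      intro n
      rw [IsGalois.mem_bot_iff_fixed]
      intro τ
      have := congrArg (fun y => y.coeff n) (map_sum (mapAlgHom (p := p) (τ : B →ₐ[A] B))
        (fun σ : B ≃ₐ[A] B => mapAlgHom (σ : B →ₐ[A] B) x) Finset.univ)
      simp only [mapAlgHom_coeff, hmul] at this
      refine this.trans ?_
      congr 1
      exact Fintype.sum_equiv (Equiv.mulLeft τ) _ _ fun _ => rfl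
    choose z hz using fun n => IntermediateField.mem_bot.1 (hfix n)
    exact ⟨.mk p z, by ext n; exact hz n⟩
  rw [← hz]
  congr 1
  have hone' : b.repr (b 1) 1 = 1 := by simp
  have hb1 : b 1 = θ := by simp [b, hone]
  rw [Algebra.trace_eq_matrix_trace b, Matrix.trace]
  -- The diagonal entry at `σ` is the coordinate of `x * σθ` at `σθ`. Applying `σ⁻¹` turns it into
  -- the coordinate of `σ⁻¹x * θ` at `θ`; these add up to the coordinate of `z • θ`.
  calc ∑ σ, Algebra.leftMulMatrix b x σ σ
      = ∑ σ : B ≃ₐ[A] B, b.repr (mapAlgHom ((σ⁻¹ : B ≃ₐ[A] B) : B →ₐ[A] B) x * θ) 1 := by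
        refine Finset.sum_congr rfl fun σ _ => ?_
        rw [Algebra.leftMulMatrix_eq_repr_mul, ← hrepr σ,
          _root_.map_mul (mapAlgHom (σ : B →ₐ[A] B)), hmul, mul_inv_cancel, hone]
        simp [b]
    _ = b.repr ((∑ σ : B ≃ₐ[A] B, mapAlgHom (σ : B →ₐ[A] B) x) * θ) 1 := by
        rw [← Equiv.sum_comp (Equiv.inv (B ≃ₐ[A] B)) fun σ => mapAlgHom (σ : B →ₐ[A] B) x,
          Finset.sum_mul, map_sum, Finset.sum_apply']
        rfl
    _ = z := by
        rw [← hz, ← Algebra.smul_def, map_smul, Finsupp.smul_apply, ← hb1, hone', smul_eq_mul,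
          mul_one]

lemma constantCoeff_trace_witt (x : WittVector p B) :
    constantCoeff (Algebra.trace (WittVector p A) (WittVector p B) x) =
      Algebra.trace A B (constantCoeff x) := by
  apply (algebraMap A B).injective
  rw [← constantCoeff_map, ← algebraMap_witt, algebraMap_trace_witt, map_sum,
    trace_eq_sum_automorphisms]
  rfl

end NormalBasis

/-! ### Truncation as congruence modulo powers of p -/

section Truncation

variable {p : ℕ} [Fact p.Prime]

lemma truncate_eq_truncate_iff {R : Type*} [CommRing R] {n : ℕ} {x y : WittVector p R} :
    truncate n x = truncate n y ↔ ∀ i < n, x.coeff i = y.coeff i := by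
  refine ⟨fun h i hi => ?_, fun h => ?_⟩
  · rw [← coeff_truncate x ⟨i, hi⟩, h, coeff_truncate]
  · ext i
    simp [h i i.2]

lemma eq_of_forall_truncate_eq {R : Type*} [CommRing R] {x y : WittVector p R}
    (h : ∀ n, truncate n x = truncate n y) : x = y := by
  ext n
  exact truncate_eq_truncate_iff.1 (h (n + 1)) n n.lt_succ_self

lemma truncate_map_eq_truncate_map {R S : Type*} [CommRing R] [CommRing S] (f : R →+* S) {n : ℕ}
    {x y : WittVector p R} (h : truncate n x = truncate n y) :
    truncate n (WittVector.map f x) = truncate n (WittVector.map f y) := by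
  rw [truncate_eq_truncate_iff] at h ⊢
  intro i hi
  rw [WittVector.map_coeff, WittVector.map_coeff, h i hi]

lemma truncate_eq_of_truncate_map_eq {R S : Type*} [CommRing R] [CommRing S] {f : R →+* S}
    (hf : Function.Injective f) {n : ℕ} {x y : WittVector p R}
    (h : truncate n (WittVector.map f x) = truncate n (WittVector.map f y)) :
    truncate n x = truncate n y := by
  rw [truncate_eq_truncate_iff] at h ⊢
  intro i hi
  simpa only [WittVector.map_coeff, hf.eq_iff] using h i hi

lemma truncate_eq_truncate_iff_pow_dvd_sub {R : Type*} [CommRing R] [CharP R p] [PerfectRing R p]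
    {n : ℕ} {x y : WittVector p R} :
    truncate n x = truncate n y ↔ (p : WittVector p R) ^ n ∣ x - y := by
  rw [truncate_eq_truncate_iff, le_coeff_eq_iff_le_sub_coeff_eq_zero,
    ← mem_span_p_pow_iff_le_coeff_eq_zero, Ideal.mem_span_singleton]

lemma truncate_linearMap_eq {A B C : Type*} [Field A] [Field B] [Field C] [Algebra A B]
    [Algebra A C] [CharP B p] [PerfectRing B p] [CharP C p] [PerfectRing C p]
    (f : WittVector p B →ₗ[WittVector p A] WittVector p C) {n : ℕ} {x y : WittVector p B}
    (h : truncate n x = truncate n y) : truncate n (f x) = truncate n (f y) := by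
  rw [truncate_eq_truncate_iff_pow_dvd_sub] at h ⊢
  obtain ⟨z, hz⟩ := h
  refine ⟨f z, ?_⟩
  have : (p : WittVector p B) ^ n * z = (p : WittVector p A) ^ n • z := by
    rw [smul_witt, map_pow, map_natCast]
  rw [← map_sub, hz, this, map_smul, smul_witt, map_pow, map_natCast]

end Truncation

/-! ### Equivariance of the trace in towers -/

section Tower

variable {p : ℕ} [Fact p.Prime] {K A B : Type*} [Field K] [Field A] [Field B] [Algebra K A]
  [Algebra K B] [Algebra A B] [IsScalarTower K A B]

instance isScalarTower_witt :
    IsScalarTower (WittVector p K) (WittVector p A) (WittVector p B) :=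
  .of_algebraMap_eq fun x => by
    ext n
    simp [algebraMap_witt, WittVector.map_coeff, ← IsScalarTower.algebraMap_apply]

lemma trace_mapAlgHom [Normal K A] (σ : B ≃ₐ[K] B) (x : WittVector p B) :
    Algebra.trace (WittVector p A) (WittVector p B) (mapAlgHom (σ : B →ₐ[K] B) x) =
      mapAlgHom (AlgEquiv.restrictNormal σ A : A →ₐ[K] A)
        (Algebra.trace (WittVector p A) (WittVector p B) x) := by
  rw [Algebra.trace_eq_of_equiv_equiv
    (wittAut p (AlgEquiv.restrictNormal σ A : A ≃+* A)) (wittAut p (σ : B ≃+* B)) (by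
      ext y n
      exact AlgEquiv.restrictNormal_commutes σ A (y.coeff n)) x]
  exact ((wittAut p (AlgEquiv.restrictNormal σ A : A ≃+* A)).apply_symm_apply _).symm

end Tower

/-! ### Compactness and trace-compatible normal generators -/

section IntermediateField

variable {p : ℕ} [Fact p.Prime] {k K : Type*} [Field k] [Field K] [Algebra k K]

instance charP_intermediateField [CharP k p] (E : IntermediateField k K) : CharP E p :=
  charP_of_injective_algebraMap (algebraMap k E).injective p

instance finite_intermediateField [Finite k] (E : IntermediateField k K)
    [FiniteDimensional k E] : Finite E :=
  Module.finite_of_finite k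

/-- The inclusion of intermediate fields as an algebra. -/
abbrev inclAlgebra {E L : IntermediateField k K} (h : E ≤ L) : Algebra E L :=
  (IntermediateField.inclusion h : E →+* L).toAlgebra

lemma isScalarTower_inclAlgebra {E L : IntermediateField k K} (h : E ≤ L) :
    letI := inclAlgebra h
    IsScalarTower k E L :=
  letI := inclAlgebra h
  .of_algebraMap_eq fun _ => rfl

variable [Finite k] [CharP k p]

lemma trace_trace {E L M : IntermediateField k K} [FiniteDimensional k E] [FiniteDimensional k L]
    [FiniteDimensional k M] (h : E ≤ L) (h' : L ≤ M) (x : WittVector p M) :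
    trace p h (trace p h' x) = trace p (h.trans h') x := by
  let := inclAlgebra h
  let := inclAlgebra h'
  let := inclAlgebra (h.trans h')
  have := isScalarTower_inclAlgebra h
  have := isScalarTower_inclAlgebra h'
  have : IsScalarTower E L M := .of_algebraMap_eq fun _ => rfl
  have : FiniteDimensional E L := .right k E L
  have : FiniteDimensional L M := .right k L M
  have := free_witt p E L
  have := free_witt p L M
  have := finite_witt p E L
  have := finite_witt p L M
  exact Algebra.trace_trace (R := WittVector p E) (S := WittVector p L) x

lemma isNormalElement_trace {E L : IntermediateField k K} [FiniteDimensional k E]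
    [FiniteDimensional k L] (h : E ≤ L) {x : WittVector p L}
    (hx : IsNormalElement k (constantCoeff x)) :
    IsNormalElement k (constantCoeff (trace p h x)) := by
  let := inclAlgebra h
  have := isScalarTower_inclAlgebra h
  have : FiniteDimensional E L := .right k E L
  have htr : constantCoeff (trace p h x) = Algebra.trace E L (constantCoeff x) :=
    constantCoeff_trace_witt x
  rw [htr]
  exact hx.trace

lemma truncate_trace_eq {E L : IntermediateField k K} [FiniteDimensional k E]
    [FiniteDimensional k L] (h : E ≤ L) {n : ℕ} {x y : WittVector p L}
    (hxy : truncate n x = truncate n y) :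
    truncate n (trace p h x) = truncate n (trace p h y) := by
  let := inclAlgebra h
  have := isScalarTower_inclAlgebra h
  exact truncate_linearMap_eq (Algebra.trace (WittVector p E) (WittVector p L)) hxy

lemma continuous_of_forall_lt_eq {X Y : Type*} [TopologicalSpace X] [DiscreteTopology X]
    [TopologicalSpace Y] [Zero X] (f : (ℕ → X) → Y) (n : ℕ)
    (hf : ∀ x y : ℕ → X, (∀ i < n, x i = y i) → f x = f y) : Continuous f := by
  let g : (Fin n → X) → Y := fun z => f fun i => if h : i < n then z ⟨i, h⟩ else 0
  have : f = g ∘ fun x i => x i := by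
    funext x
    exact hf _ _ fun i hi => by simp [hi]
  rw [this]
  exact continuous_of_discreteTopology.comp (by fun_prop)

variable (p k K) in
lemma exists_compatible_isNormalElement :
    ∃ θ : ∀ (E : IntermediateField k K) [FiniteDimensional k E], WittVector p E,
      (∀ (E : IntermediateField k K) [FiniteDimensional k E],
        IsNormalElement k (constantCoeff (θ E))) ∧
      ∀ (E L : IntermediateField k K) [FiniteDimensional k E] [FiniteDimensional k L]
        (h : E ≤ L), trace p h (θ L) = θ E := by
  let I := {E : IntermediateField k K // FiniteDimensional k E}
  have (E : I) : FiniteDimensional k E.1 := E.2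
  let (E : I) : TopologicalSpace E.1 := ⊥
  have (E : I) : DiscreteTopology E.1 := ⟨rfl⟩
  -- Normality is imposed at `L` alone, since traces pass it down to subfields. This makes `C`
  -- antitone, hence directed.
  let C : I → Set (∀ E : I, ℕ → E.1) := fun L =>
    {x | IsNormalElement k (constantCoeff (.mk p (x L) : WittVector p L.1)) ∧
      ∀ (E : I) (h : E.1 ≤ L.1), trace p h (.mk p (x L)) = .mk p (x E)}
  have : Nonempty I := ⟨⟨⊥, inferInstance⟩⟩
  have hclosed : ∀ L, IsClosed (C L) := by
    intro L
    refine IsClosed.inter ?_ ?_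
    · have hc : Continuous fun x : ∀ E : I, ℕ → E.1 => x L 0 := by fun_prop
      exact (isClosed_discrete {a : L.1 | IsNormalElement k a}).preimage hc
    · have : {x : ∀ E : I, ℕ → E.1 | ∀ (E : I) (h : E.1 ≤ L.1),
          trace p h (.mk p (x L)) = .mk p (x E)} =
          ⋂ (E : I) (h : E.1 ≤ L.1) (n : ℕ),
            {x | (trace p h (.mk p (x L))).coeff n = x E n} := by
        ext x
        simp only [Set.mem_ofPred_eq, Set.mem_iInter, WittVector.ext_iff]
        rfl
      change IsClosed {x : ∀ E : I, ℕ → E.1 | ∀ (E : I) (h : E.1 ≤ L.1),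
          trace p h (.mk p (x L)) = .mk p (x E)}
      rw [this]
      refine isClosed_iInter fun E => isClosed_iInter fun h => isClosed_iInter fun n => ?_
      refine isClosed_eq ?_ (by fun_prop)
      -- Coefficient `n` of the trace depends only on the first `n + 1` coefficients, because the
      -- trace preserves congruence mod p^(n+1).
      have hc : Continuous fun x : ℕ → L.1 => (trace p h (.mk p x)).coeff n :=
        continuous_of_forall_lt_eq _ (n + 1) fun x y hxy =>
          truncate_eq_truncate_iff.1 (truncate_trace_eq h (n := n + 1)
            (truncate_eq_truncate_iff.2 hxy)) n n.lt_succ_self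
      exact hc.comp (continuous_apply L)
  have hne : ∀ L, (C L).Nonempty := by
    classical
    intro L
    obtain ⟨η, hη⟩ := exists_isNormalElement_constantCoeff p k L.1
    -- `C L` does not constrain fields outside `L`, so 0 serves there.
    refine ⟨fun E => if h : E.1 ≤ L.1 then (trace p h η).coeff else 0, ?_, fun E h => ?_⟩
    · simpa using! isNormalElement_trace le_rfl hη
    · simp only [le_refl, h, dite_true]
      exact trace_trace h le_rfl η
  have hanti : ∀ {L M : I}, L.1 ≤ M.1 → C M ⊆ C L := by
    rintro L M hLM x ⟨hx, hx'⟩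
    refine ⟨?_, fun E h => ?_⟩
    · rw [← hx' L hLM]
      exact isNormalElement_trace hLM hx
    · rw [← hx' L hLM, trace_trace, hx']
  have hdir : Directed (· ⊇ ·) C := fun L M =>
    ⟨⟨L.1 ⊔ M.1, inferInstance⟩, hanti le_sup_left, hanti le_sup_right⟩
  obtain ⟨x, hx⟩ := IsCompact.nonempty_iInter_of_directed_nonempty_isCompact_isClosed C hdir hne
    (fun L => (hclosed L).isCompact) hclosed
  rw [Set.mem_iInter] at hx
  exact ⟨fun E hE => .mk p (x ⟨E, hE⟩), fun E hE => (hx ⟨E, hE⟩).1,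
    fun E L hE hL h => (hx ⟨L, hL⟩).2 ⟨E, hE⟩ h⟩

end IntermediateField

/-! ### The involution attached to a normal basis -/

section Inversion

variable {p : ℕ} [Fact p.Prime] {K B : Type*} [Field K] [Field B] [Algebra K B]

lemma mapAlgHom_mul (σ τ : B ≃ₐ[K] B) (x : WittVector p B) :
    mapAlgHom ((σ * τ : B ≃ₐ[K] B) : B →ₐ[K] B) x =
      mapAlgHom (σ : B →ₐ[K] B) (mapAlgHom (τ : B →ₐ[K] B) x) := rfl

lemma mapAlgHom_one (x : WittVector p B) :
    mapAlgHom ((1 : B ≃ₐ[K] B) : B →ₐ[K] B) x = x := by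
  ext
  simp

lemma frob_zpow_apply {k E : Type*} [Field k] [Fintype k] [Field E] [Algebra k E]
    [Algebra.IsAlgebraic k E] (i : ℤ) (x : WittVector p E) :
    (frob p k E ^ i) x =
      mapAlgHom ((FiniteField.frobeniusAlgEquivOfAlgebraic k E ^ i : E ≃ₐ[k] E) : E →ₐ[k] E) x := by
  let W : (E ≃ₐ[k] E) →* RingAut (WittVector p E) :=
    { toFun := fun σ => wittAut p (σ : E ≃+* E)
      map_one' := by
        ext x n
        exact congrArg (fun y => y.coeff n) (mapAlgHom_one (K := k) x)
      map_mul' := fun σ τ => rfl }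
  exact (congrArg (fun e : RingAut (WittVector p E) => e x)
    (map_zpow W (FiniteField.frobeniusAlgEquivOfAlgebraic k E) i)).symm

variable [FiniteDimensional K B] [IsGalois K B] [CharP K p] [CharP B p] [PerfectRing K p]
  [PerfectRing B p] {θ : WittVector p B} (h : IsNormalElement K (constantCoeff θ))

include h in
lemma isNormalBasisGenerator [Fintype K] : IsNormalBasisGenerator p K θ := by
  have : Finite B := Module.finite_of_finite K
  -- The Frobenius powers with exponent below the degree run through the Galois group exactly once.
  let e := Equiv.ofBijective _ (FiniteField.bijective_frobeniusAlgEquivOfAlgebraic_pow K B)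
  have hv : (fun i : Fin (Module.finrank K B) => (frob p K B ^ (i : ℕ)) θ) =
      (wittNormalBasis h).reindex e.symm := by
    funext i
    rw [Module.Basis.reindex_apply, wittNormalBasis_apply, ← zpow_natCast, frob_zpow_apply,
      zpow_natCast]
    rfl
  unfold IsNormalBasisGenerator
  rw [hv]
  exact ⟨Module.Basis.linearIndependent _, Module.Basis.span_eq _⟩

/-- The linear map that sends each conjugate `σ θ` of a normal basis generator to `σ⁻¹ θ`. -/
noncomputable def inversion : WittVector p B →ₗ[WittVector p K] WittVector p B :=
  (wittNormalBasis h).constr ℕ fun σ => mapAlgHom ((σ⁻¹ : B ≃ₐ[K] B) : B →ₐ[K] B) θ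

lemma inversion_conj (σ : B ≃ₐ[K] B) :
    inversion h (mapAlgHom (σ : B →ₐ[K] B) θ) =
      mapAlgHom ((σ⁻¹ : B ≃ₐ[K] B) : B →ₐ[K] B) θ := by
  rw [← wittNormalBasis_apply h, inversion, Module.Basis.constr_basis]

lemma inversion_inversion (x : WittVector p B) : inversion h (inversion h x) = x := by
  have : (inversion h).comp (inversion h) = LinearMap.id :=
    (wittNormalBasis h).ext fun σ => by
      rw [wittNormalBasis_apply, LinearMap.comp_apply, inversion_conj, inversion_conj, inv_inv,
        LinearMap.id_apply]
  exact LinearMap.congr_fun this x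

lemma inversion_mapAlgHom [IsMulCommutative (B ≃ₐ[K] B)] (σ : B ≃ₐ[K] B) (x : WittVector p B) :
    inversion h (mapAlgHom (σ : B →ₐ[K] B) x) =
      mapAlgHom ((σ⁻¹ : B ≃ₐ[K] B) : B →ₐ[K] B) (inversion h x) := by
  have : (inversion h).comp (mapAlgHom (σ : B →ₐ[K] B)).toLinearMap =
      (mapAlgHom ((σ⁻¹ : B ≃ₐ[K] B) : B →ₐ[K] B)).toLinearMap.comp (inversion h) :=
    (wittNormalBasis h).ext fun τ => by
      rw [wittNormalBasis_apply, LinearMap.comp_apply, LinearMap.comp_apply,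
        AlgHom.toLinearMap_apply, AlgHom.toLinearMap_apply, ← mapAlgHom_mul, inversion_conj,
        inversion_conj, ← mapAlgHom_mul, mul_inv_rev, mul_comm']
  exact LinearMap.congr_fun this x

variable {A : Type*} [Field A] [Algebra K A] [Algebra A B] [IsScalarTower K A B]
  [FiniteDimensional K A] [IsGalois K A] [CharP A p] [PerfectRing A p] {η : WittVector p A}
  (h' : IsNormalElement K (constantCoeff η))
  (hη : Algebra.trace (WittVector p A) (WittVector p B) θ = η)

include hη in
lemma trace_inversion (x : WittVector p B) :
    Algebra.trace (WittVector p A) (WittVector p B) (inversion h x) =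
      inversion h' (Algebra.trace (WittVector p A) (WittVector p B) x) := by
  let T := (Algebra.trace (WittVector p A) (WittVector p B)).restrictScalars (WittVector p K)
  have : T.comp (inversion h) = (inversion h').comp T :=
    (wittNormalBasis h).ext fun σ => by
      rw [wittNormalBasis_apply, LinearMap.comp_apply, LinearMap.comp_apply, inversion_conj]
      simp only [T, LinearMap.restrictScalars_apply, trace_mapAlgHom, hη, inversion_conj]
      congr 3
      exact map_inv (AlgEquiv.restrictNormalHom A) σ
  exact LinearMap.congr_fun this x

include hη in
-- In W(B), η is the sum of σθ over Gal(B/A), and σ ↦ σ⁻¹ only permutes the terms, so η is fixed.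
-- Its other conjugates follow by lifting automorphisms of A to B and using commutativity.
lemma inversion_algebraMap [IsMulCommutative (B ≃ₐ[K] B)] (x : WittVector p A) :
    inversion h (algebraMap (WittVector p A) (WittVector p B) x) =
      algebraMap (WittVector p A) (WittVector p B) (inversion h' x) := by
  have : IsGalois A B := IsGalois.tower_top_of_isGalois K A B
  have : FiniteDimensional A B := .right K A B
  have hfix : inversion h (algebraMap (WittVector p A) (WittVector p B) η) =
      algebraMap (WittVector p A) (WittVector p B) η := by
    rw [← hη, algebraMap_trace_witt, map_sum]
    refine Fintype.sum_equiv (Equiv.inv (B ≃ₐ[A] B)) _ _ fun σ => ?_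
    exact inversion_conj h (AlgEquiv.restrictScalars K σ)
  have hmap : ∀ (σ : B ≃ₐ[K] B) (y : WittVector p A),
      algebraMap (WittVector p A) (WittVector p B)
        (mapAlgHom (AlgEquiv.restrictNormalHom A σ : A →ₐ[K] A) y) =
      mapAlgHom (σ : B →ₐ[K] B) (algebraMap (WittVector p A) (WittVector p B) y) := by
    intro σ y
    ext n
    exact AlgEquiv.restrictNormal_commutes σ A (y.coeff n)
  let ι := (IsScalarTower.toAlgHom (WittVector p K) (WittVector p A) (WittVector p B)).toLinearMap
  have : (inversion h).comp ι = ι.comp (inversion h') :=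
    (wittNormalBasis h').ext fun ρ => by
      obtain ⟨σ, rfl⟩ := AlgEquiv.restrictNormalHom_surjective (F := K) (K₁ := A) B ρ
      rw [wittNormalBasis_apply, LinearMap.comp_apply, LinearMap.comp_apply, inversion_conj,
        ← map_inv]
      simp only [ι, AlgHom.toLinearMap_apply, IsScalarTower.coe_toAlgHom']
      rw [hmap, hmap, inversion_mapAlgHom, hfix]
  exact LinearMap.congr_fun this x

end Inversion

/-! ### Extension by p-adic density to an infinite algebraic extension -/

section Extension

variable {p : ℕ} [Fact p.Prime] {k K : Type*} [Field k] [Field K] [Algebra k K]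

lemma map_algebraMap_incl {E L : IntermediateField k K} (h : E ≤ L) (x : WittVector p E) :
    WittVector.map (algebraMap L K) (incl p h x) = WittVector.map (algebraMap E K) x := rfl

/-- The first n coefficients generate a finite extension. This is the density of the union of the
W(E), which need not be all of W(K). -/
lemma exists_truncate_map_eq [Algebra.IsAlgebraic k K] (n : ℕ) (x : WittVector p K) :
    ∃ (E : IntermediateField k K) (_ : FiniteDimensional k E) (y : WittVector p E),
      truncate n (WittVector.map (algebraMap E K) y) = truncate n x := by
  let S : Set K := x.coeff '' Set.Iio n
  have hS : ∀ i < n, x.coeff i ∈ IntermediateField.adjoin k S := fun i hi =>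
    IntermediateField.subset_adjoin k S ⟨i, hi, rfl⟩
  have : Finite S := (Set.finite_Iio n).image _
  refine ⟨IntermediateField.adjoin k S,
    IntermediateField.finiteDimensional_adjoin fun a _ => Algebra.IsIntegral.isIntegral a,
    .mk p fun i => if hi : i < n then ⟨x.coeff i, hS i hi⟩ else 0, ?_⟩
  rw [truncate_eq_truncate_iff]
  intro i hi
  simp [WittVector.map_coeff, hi]

lemma exists_truncate_map_eq_pair [Algebra.IsAlgebraic k K] (n : ℕ) (x x' : WittVector p K) :
    ∃ (E : IntermediateField k K) (_ : FiniteDimensional k E) (y y' : WittVector p E),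
      truncate n (WittVector.map (algebraMap E K) y) = truncate n x ∧
        truncate n (WittVector.map (algebraMap E K) y') = truncate n x' := by
  obtain ⟨E, _, y, hy⟩ := exists_truncate_map_eq (k := k) n x
  obtain ⟨E', _, y', hy'⟩ := exists_truncate_map_eq (k := k) n x'
  exact ⟨E ⊔ E', inferInstance, incl p le_sup_left y, incl p le_sup_right y', hy, hy'⟩

lemma map_algebraMap_smul (E : IntermediateField k K) (c : WittVector p k) (y : WittVector p E) :
    WittVector.map (algebraMap E K) (c • y) = c • WittVector.map (algebraMap E K) y :=
  (mapAlgHom (IsScalarTower.toAlgHom k E K)).toLinearMap.map_smul c y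

/-- Continuity is automatic: linearity over W(k) already forces p^n W(K) into itself. -/
lemma continuous_linearMap_witt [CharP K p] [PerfectRing K p]
    (τ : WittVector p K →ₗ[WittVector p k] WittVector p K) :
    Continuous[padicTopology p K, padicTopology p K] τ := by
  let J := Ideal.span {(p : WittVector p K)}
  let _ : TopologicalSpace (WittVector p K) := padicTopology p K
  have : Continuous τ := by
    rw [continuous_iff_continuousAt]
    intro x
    rw [ContinuousAt, (J.hasBasis_nhds_adic x).tendsto_iff (J.hasBasis_nhds_adic (τ x))]
    refine fun n _ => ⟨n, trivial, ?_⟩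
    rintro _ ⟨y, hy, rfl⟩
    refine ⟨τ y, ?_, (τ.map_add x y).symm⟩
    have hmem : ∀ z : WittVector p K, z ∈ ((J ^ n : Ideal (WittVector p K)) : Set _) ↔
        truncate n z = truncate n 0 := by
      intro z
      rw [truncate_eq_truncate_iff_pow_dvd_sub, sub_zero, SetLike.mem_coe,
        Ideal.span_singleton_pow, Ideal.mem_span_singleton]
    rw [hmem] at hy ⊢
    rw [← τ.map_zero]
    exact truncate_linearMap_eq τ hy
  exact this

variable [Algebra.IsAlgebraic k K] [Finite k] [CharP k p]

/-- A compatible family of linear endomorphisms of the `W(E)` extends to `W(K)`. -/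
lemma exists_linearMap_extending
    (f : ∀ (E : IntermediateField k K) [FiniteDimensional k E],
      WittVector p E →ₗ[WittVector p k] WittVector p E)
    (hf : ∀ (E L : IntermediateField k K) [FiniteDimensional k E] [FiniteDimensional k L]
      (h : E ≤ L) (x : WittVector p E), f L (incl p h x) = incl p h (f E x)) :
    ∃ τ : WittVector p K →ₗ[WittVector p k] WittVector p K,
      ∀ (n : ℕ) (E : IntermediateField k K) [FiniteDimensional k E] (y : WittVector p E)
        (x : WittVector p K), truncate n (WittVector.map (algebraMap E K) y) = truncate n x →
        truncate n (WittVector.map (algebraMap E K) (f E y)) = truncate n (τ x) := by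
  have hcons : ∀ (n : ℕ) (E E' : IntermediateField k K) [FiniteDimensional k E]
      [FiniteDimensional k E'] (y : WittVector p E) (y' : WittVector p E'),
      truncate n (WittVector.map (algebraMap E K) y) =
        truncate n (WittVector.map (algebraMap E' K) y') →
      truncate n (WittVector.map (algebraMap E K) (f E y)) =
        truncate n (WittVector.map (algebraMap E' K) (f E' y')) := by
    intro n E E' _ _ y y' h
    -- Two approximations are compared in the compositum, where both come from the same linear map.
    have hE : E ≤ E ⊔ E' := le_sup_left
    have hE' : E' ≤ E ⊔ E' := le_sup_right
    rw [← map_algebraMap_incl hE, ← map_algebraMap_incl hE'] at h ⊢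
    rw [← hf, ← hf]
    exact truncate_map_eq_truncate_map _ (truncate_linearMap_eq _
      (truncate_eq_of_truncate_map_eq Subtype.val_injective h))
  choose F hF Y hY using fun (n : ℕ) (x : WittVector p K) => exists_truncate_map_eq (k := k) n x
  -- Coefficient `n` is determined by the truncation of length `n + 1`, hence the shifted index.
  let τ : WittVector p K → WittVector p K := fun x =>
    .mk p fun n => (WittVector.map (algebraMap (F (n + 1) x) K)
      (f (F (n + 1) x) (Y (n + 1) x))).coeff n
  have hτ : ∀ (n : ℕ) (E : IntermediateField k K) [FiniteDimensional k E] (y : WittVector p E)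
      (x : WittVector p K), truncate n (WittVector.map (algebraMap E K) y) = truncate n x →
      truncate n (WittVector.map (algebraMap E K) (f E y)) = truncate n (τ x) := by
    intro n E _ y x h
    rw [truncate_eq_truncate_iff] at h ⊢
    intro i hi
    refine truncate_eq_truncate_iff.1 (hcons (i + 1) E (F (i + 1) x) y (Y (i + 1) x) ?_) i
      i.lt_succ_self
    rw [hY, truncate_eq_truncate_iff]
    exact fun j hj => h j (by omega)
  refine ⟨{ toFun := τ, map_add' := fun x x' => ?_, map_smul' := fun c x => ?_ }, hτ⟩
  · refine eq_of_forall_truncate_eq fun n => ?_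
    obtain ⟨E, _, y, y', hy, hy'⟩ := exists_truncate_map_eq_pair (k := k) n x x'
    rw [← hτ n E (y + y') (x + x') (by simp only [_root_.map_add, hy, hy'])]
    simp only [_root_.map_add, hτ n E y x hy, hτ n E y' x' hy']
  · refine eq_of_forall_truncate_eq fun n => ?_
    obtain ⟨E, _, y, hy⟩ := exists_truncate_map_eq (k := k) n x
    have hsmul : ∀ z z' : WittVector p K, truncate n z = truncate n z' →
        truncate n (c • z) = truncate n (c • z') := fun z z' hz => by
      rw [smul_witt, smul_witt, _root_.map_mul, _root_.map_mul, hz]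
    rw [RingHom.id_apply, ← hτ n E (c • y) (c • x) (by rw [map_algebraMap_smul, hsmul _ _ hy]),
      map_smul, map_algebraMap_smul, hsmul _ _ (hτ n E y x hy)]

end Extension

end WittInvolution

/-! ### Assembly of the involution -/

theorem mainTheorem4 (p : ℕ) [Fact p.Prime] (k kbar : Type*) [Field k] [Fintype k] [CharP k p]
    [Field kbar] [Algebra k kbar] [IsAlgClosure k kbar] :
    ∃ (θ : ∀ (E : IntermediateField k kbar) [FiniteDimensional k E], WittVector p E)
      (τ : WittVector p kbar →ₗ[WittVector p k] WittVector p kbar)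
      (τE : ∀ (E : IntermediateField k kbar) [FiniteDimensional k E],
        WittVector p E →ₗ[WittVector p k] WittVector p E),
      -- `θ` is a trace-compatible system of normal basis generators
      (∀ (E : IntermediateField k kbar) [FiniteDimensional k E],
        WittInvolution.IsNormalBasisGenerator p k (θ E)) ∧
      (∀ (E L : IntermediateField k kbar) [FiniteDimensional k E] [FiniteDimensional k L]
        (h : E ≤ L), WittInvolution.trace p h (θ L) = θ E) ∧
      -- `τ` is a continuous involution that inverts the Frobenius `π`
      Continuous[WittInvolution.padicTopology p kbar, WittInvolution.padicTopology p kbar] τ ∧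
      (∀ x, τ (τ x) = x) ∧
      (∀ x, τ (WittInvolution.frob p k kbar x) = (WittInvolution.frob p k kbar)⁻¹ (τ x)) ∧
      -- `τ` preserves `W(E) ⊆ W(kbar)`, where it restricts to `τE E`
      (∀ (E : IntermediateField k kbar) [FiniteDimensional k E] (x : WittVector p E),
        τ (WittVector.map (algebraMap E kbar) x) = WittVector.map (algebraMap E kbar) (τE E x)) ∧
      -- the restrictions commute with traces and inclusions
      (∀ (E L : IntermediateField k kbar) [FiniteDimensional k E] [FiniteDimensional k L]
        (h : E ≤ L), (∀ x : WittVector p L,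
            WittInvolution.trace p h (τE L x) = τE E (WittInvolution.trace p h x)) ∧
          ∀ x : WittVector p E,
            τE L (WittInvolution.incl p h x) = WittInvolution.incl p h (τE E x)) ∧
      -- `τ` is built from `θ`: it sends `π ^ i θ` to `π ^ (-i) θ`
      (∀ (E : IntermediateField k kbar) [FiniteDimensional k E] (i : ℤ),
        τE E ((WittInvolution.frob p k E ^ i) (θ E)) =
          (WittInvolution.frob p k E ^ (-i)) (θ E)) := by
  have : Algebra.IsAlgebraic k kbar := IsAlgClosure.isAlgebraic
  have : IsAlgClosed kbar := IsAlgClosure.isAlgClosed k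
  have : CharP kbar p := charP_of_injective_algebraMap (algebraMap k kbar).injective p
  obtain ⟨θ, hθ, hθtr⟩ := WittInvolution.exists_compatible_isNormalElement p k kbar
  let f : ∀ (E : IntermediateField k kbar) [FiniteDimensional k E],
      WittVector p E →ₗ[WittVector p k] WittVector p E :=
    fun E _ => WittInvolution.inversion (hθ E)
  have hincl : ∀ (E L : IntermediateField k kbar) [FiniteDimensional k E] [FiniteDimensional k L]
      (h : E ≤ L) (x : WittVector p E),
      f L (WittInvolution.incl p h x) = WittInvolution.incl p h (f E x) := by
    intro E L _ _ h x
    let := WittInvolution.inclAlgebra h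
    have := WittInvolution.isScalarTower_inclAlgebra h
    exact WittInvolution.inversion_algebraMap (hθ L) (hθ E) (hθtr E L h) x
  obtain ⟨τ, hτ⟩ := WittInvolution.exists_linearMap_extending f hincl
  refine ⟨θ, τ, f, fun E _ => WittInvolution.isNormalBasisGenerator (hθ E), hθtr,
    WittInvolution.continuous_linearMap_witt τ, fun x => ?_, fun x => ?_, fun E _ x => ?_,
    fun E L _ _ h => ⟨fun x => ?_, hincl E L h⟩, fun E _ i => ?_⟩
  · refine WittInvolution.eq_of_forall_truncate_eq fun n => ?_
    obtain ⟨E, _, y, hy⟩ := WittInvolution.exists_truncate_map_eq (k := k) n x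
    rw [← hτ n E _ _ (hτ n E y x hy), ← hy]
    simp only [f, WittInvolution.inversion_inversion]
  · refine WittInvolution.eq_of_forall_truncate_eq fun n => ?_
    obtain ⟨E, _, y, hy⟩ := WittInvolution.exists_truncate_map_eq (k := k) n x
    have hmap : ∀ z : WittVector p E, WittVector.map (algebraMap E kbar)
        (WittInvolution.frob p k E z) =
          WittInvolution.frob p k kbar (WittVector.map (algebraMap E kbar) z) := by
      intro z
      ext i
      exact map_pow (algebraMap E kbar) (z.coeff i) _
    have hmap_inv : ∀ z : WittVector p E, WittVector.map (algebraMap E kbar)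
        ((WittInvolution.frob p k E)⁻¹ z) =
          (WittInvolution.frob p k kbar)⁻¹ (WittVector.map (algebraMap E kbar) z) := by
      intro z
      apply (WittInvolution.frob p k kbar).injective
      rw [← hmap, ← RingAut.mul_apply, ← RingAut.mul_apply, mul_inv_cancel, mul_inv_cancel]
      rfl
    have hfrob : WittVector.truncate n (WittVector.map (algebraMap E kbar)
        (WittInvolution.frob p k E y)) =
          WittVector.truncate n (WittInvolution.frob p k kbar x) := by
      rw [hmap]
      exact WittInvolution.truncate_map_eq_truncate_map _ hy
    have hinv : f E (WittInvolution.frob p k E y) = (WittInvolution.frob p k E)⁻¹ (f E y) :=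
      WittInvolution.inversion_mapAlgHom (hθ E) _ y
    rw [← hτ n E _ _ hfrob, hinv, hmap_inv]
    -- The inverse of π acts coefficientwise by the inverse Frobenius, so it respects truncations.
    exact WittInvolution.truncate_map_eq_truncate_map
      ((FiniteField.frobeniusAlgEquivOfAlgebraic k kbar : kbar ≃+* kbar).symm : kbar →+* kbar)
      (hτ n E y x hy)
  · exact WittInvolution.eq_of_forall_truncate_eq fun n => (hτ n E x _ rfl).symm
  · let := WittInvolution.inclAlgebra h
    have := WittInvolution.isScalarTower_inclAlgebra h
    exact WittInvolution.trace_inversion (hθ L) (hθ E) (hθtr E L h) x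
  · rw [WittInvolution.frob_zpow_apply, WittInvolution.frob_zpow_apply, zpow_neg]
    exact WittInvolution.inversion_conj (hθ E) _
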